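/- Let $P_4$ denote the path with four vertices and three edges, and let $K_m$ denote the complete graph on $m$ vertices. A partial $(K_v,P_4)$-design is a set of pairwise edge-disjoint subgraphs of $K_v$, each isomorphic to $P_4$; a $(K_n,P_4)$-design is a set of subgraphs of $K_n$, each isomorphic to $P_4$, whose edge sets partition the edge set of $K_n$. Let $v\ge 0$ and let $n$ be an integer with $n\geq v+2$, $n\equiv 0$ or $1\pmod 3$, and $n\neq 3$. Then every partial $(K_v,P_4)$-design $\mathcal B$ can be embedded into a $(K_n,P_4)$-design: there are a $(K_n,P_4)$-design $\mathcal B'$ and an injection of the vertex set of $K_v$ into the vertex set of $K_n$ under which every element of $\mathcal B$ is mapped to an element of $\mathcal B'$. -/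

import Mathlib

namespace PathDesign

/-- A partial `(K, Γ)`-design: a set of subgraphs of `K` (the blocks), each isomorphic to `Γ`,
such that distinct blocks have no edge in common. -/
def IsPartialDesign {V U : Type*} (K : SimpleGraph V) (Γ : SimpleGraph U)
    (B : Set K.Subgraph) : Prop :=
  (∀ H ∈ B, Nonempty (H.coe ≃g Γ)) ∧ B.PairwiseDisjoint SimpleGraph.Subgraph.edgeSet

/-- A `(K, Γ)`-design: a set of subgraphs of `K`, each isomorphic to `Γ`, whose edge sets
partition the edge set of `K`. -/
def IsDesign {V U : Type*} (K : SimpleGraph V) (Γ : SimpleGraph U)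
    (B : Set K.Subgraph) : Prop :=
  IsPartialDesign K Γ B ∧ ⋃ H ∈ B, H.edgeSet = K.edgeSet

/-- A collection `B` of subgraphs of `K` is embedded in a collection `B'` of subgraphs of `K'`:
after identifying the vertices of `K` with some of the vertices of `K'`, so that `K` becomes a
subgraph of `K'`, every block of `B` is a block of `B'`. -/
def EmbedsInto {V W : Type*} {K : SimpleGraph V} {K' : SimpleGraph W}
    (B : Set K.Subgraph) (B' : Set K'.Subgraph) : Prop :=
  ∃ φ : SimpleGraph.Copy K K', ∀ H ∈ B, H.map φ.toHom ∈ B'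

end PathDesign

/-!
Any two of the vertices not used by the partial design may be singled out as `a` and `b`; the other
new vertices are regarded as old ones. The edges still to be covered are then those of the join of
the edge `ab` with an arbitrary graph `(S, L)`, where `L` is the graph of uncovered edges on the
remaining vertices `S`. Their number is `|L| + 2 |S| + 1`, and it is divisible by three, because both
the number of edges of `K_n` and the number of covered edges are. So it suffices that such a join is
always `P₄`-decomposable if its number of edges is divisible by three, with the triangle, that is
`|S| = 1`, as the only exception (`IsGraphOn.pathDecomposable`); this is where `n ≠ 3` is needed.

The proof is by induction on `|S| + |L|`, splitting off small pieces. A `P₄` inside `L` is itself a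
piece. If `L` contains no `P₄`, its components are triangles, stars and isolated vertices. The edges
meeting a triangle component, or two leaves of a common star, or three isolated vertices, can be
decomposed (the last two are copies of `K_{2,3}`), so that `L` may be assumed to be a matching with
at most two isolated vertices. For these, an edge with two isolated vertices, two edges with one
isolated vertex, and three edges are again decomposable pieces, and only `K₄` remains
(`IsGraphOn.exists_removable`). Whenever splitting off a piece would leave the triangle, either the
piece together with the triangle is decomposed directly, or another piece is available.
-/

namespace PathDesign

/-! ### Path decompositions of edge multisets -/

open SimpleGraph

/-- A multiset of edges is `P₄`-decomposable if it is a sum of edge sets of paths on four distinct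
vertices. Working with multisets turns "disjoint union" into `+`, so that an explicit decomposition
is checked by an identity in a commutative monoid; disjointness of the paths is recovered at the
end from the absence of repeated edges. -/
inductive PathDecomposable {α : Type*} : Multiset (Sym2 α) → Prop
  | zero : PathDecomposable 0
  | add (w x y z : α) {M : Multiset (Sym2 α)} (hp : [w, x, y, z].Nodup)
      (hM : PathDecomposable M) :
      PathDecomposable ({s(w, x)} + {s(x, y)} + {s(y, z)} + M)

theorem edgeSet_pathGraph_four :
    (pathGraph 4).edgeSet = {s(0, 1), s(1, 2), s(2, 3)} := by
  ext e
  induction e using Sym2.ind with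
  | _ u v =>
    rw [mem_edgeSet, pathGraph_adj]
    simp only [Set.mem_insert_iff, Set.mem_singleton_iff]
    revert u v
    decide

theorem edgeSet_toSubgraph_pathGraph_four {α : Type*} {G : SimpleGraph α}
    (f : Copy (pathGraph 4) G) :
    f.toSubgraph.edgeSet = {s(f 0, f 1), s(f 1, f 2), s(f 2, f 3)} := by
  rw [Subgraph.edgeSet_map, Subgraph.edgeSet_top, edgeSet_pathGraph_four]
  simp [Set.image_insert_eq]

theorem exists_subgraph_of_nodup {α : Type*} {w x y z : α} (hp : [w, x, y, z].Nodup) :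
    ∃ H : (completeGraph α).Subgraph, Nonempty (H.coe ≃g pathGraph 4) ∧
      H.edgeSet = {s(w, x), s(x, y), s(y, z)} := by
  have hf : Function.Injective ![w, x, y, z] := by
    rw [← List.nodup_ofFn]
    simpa using hp
  let f : Copy (pathGraph 4) (completeGraph α) :=
    ⟨⟨![w, x, y, z], fun {i j} h => hf.ne h.ne⟩, hf⟩
  exact ⟨f.toSubgraph, ⟨f.isoToSubgraph.symm⟩, edgeSet_toSubgraph_pathGraph_four f⟩

theorem ncard_edgeSet_of_iso {α : Type*} {G : SimpleGraph α} {H : G.Subgraph}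
    (h : Nonempty (H.coe ≃g pathGraph 4)) : H.edgeSet.ncard = 3 := by
  obtain ⟨e⟩ := h
  rw [← Subgraph.image_coe_edgeSet_coe,
    Set.ncard_image_of_injective _ (Sym2.map.injective Subtype.val_injective),
    Set.ncard_congr' e.mapEdgeSet, edgeSet_pathGraph_four, Set.ncard_eq_toFinset_card']
  decide

/-- The pieces of a decomposition of a multiset without repetitions are automatically
edge-disjoint. -/
theorem PathDecomposable.exists_isPartialDesign {α : Type*} {M : Multiset (Sym2 α)}
    (hM : PathDecomposable M) (hd : M.Nodup) :
    ∃ B : Set (completeGraph α).Subgraph, IsPartialDesign (completeGraph α) (pathGraph 4) B ∧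
      ⋃ H ∈ B, H.edgeSet = {e | e ∈ M} := by
  induction hM with
  | zero => exact ⟨∅, ⟨by simp, by simp⟩, by simp⟩
  | add w x y z hp _ ih =>
    obtain ⟨_, hd', hdisj⟩ := Multiset.nodup_add.1 hd
    obtain ⟨B, ⟨hB, hBd⟩, hBU⟩ := ih hd'
    obtain ⟨H, hH, hHe⟩ := exists_subgraph_of_nodup hp
    refine ⟨insert H B, ⟨?_, ?_⟩, ?_⟩
    · rintro K (rfl | hK)
      exacts [hH, hB K hK]
    · refine hBd.insert fun K hK _ => ?_
      rw [Set.disjoint_left]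
      intro e he he'
      have : e ∈ ⋃ H ∈ B, H.edgeSet := Set.mem_biUnion hK he'
      rw [hBU] at this
      rw [hHe] at he
      exact Multiset.disjoint_left.1 hdisj (by simpa [or_assoc] using he) this
    · rw [Set.biUnion_insert, hBU, hHe]
      ext e
      simp [or_assoc]

/-! ### Cones and removable parts -/

section

variable {α : Type*} {a b : α}

/-- The edges of `L` together with the edges joining the vertices of `S` to `a` and to `b`. -/
def cone (a b : α) (S : Finset α) (L : Finset (Sym2 α)) : Multiset (Sym2 α) :=
  ∑ e ∈ L, {e} + ∑ x ∈ S, ({s(a, x)} + {s(b, x)})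

/-- `L` is the edge set of a simple graph on a vertex set `S` that avoids `a` and `b`. -/
structure IsGraphOn (a b : α) (S : Finset α) (L : Finset (Sym2 α)) : Prop where
  left_notMem : a ∉ S
  right_notMem : b ∉ S
  mem_left : ∀ {x y}, s(x, y) ∈ L → x ∈ S
  ne : ∀ {x y}, s(x, y) ∈ L → x ≠ y

namespace IsGraphOn

variable {S : Finset α} {L : Finset (Sym2 α)}

theorem mem_right (h : IsGraphOn a b S L) {x y : α} (hxy : s(x, y) ∈ L) : y ∈ S :=
  h.mem_left (Sym2.eq_swap ▸ hxy)

end IsGraphOn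

variable [DecidableEq α]

theorem cone_sdiff {S S₀ : Finset α} {L L₀ : Finset (Sym2 α)} (hS : S₀ ⊆ S) (hL : L₀ ⊆ L) :
    cone a b (S \ S₀) (L \ L₀) + cone a b S₀ L₀ = cone a b S L := by
  unfold cone
  rw [← Finset.sum_sdiff hS, ← Finset.sum_sdiff hL]
  abel

/-- A part `(S₀, L₀)` of a graph `(S, L)` that can be split off in the induction: `L₀` contains all
edges of `L` meeting `S₀`, and the cone over `(S₀, L₀)` is decomposable. If a single vertex `w`
would be left over, what remains is the indecomposable triangle `a b w`; so in that case it is the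
union of this triangle and the cone over `(S₀, L₀)` that has to be decomposable. -/
structure Removable (a b : α) (S : Finset α) (L : Finset (Sym2 α)) (S₀ : Finset α)
    (L₀ : Finset (Sym2 α)) : Prop where
  subset : S₀ ⊆ S
  edges_subset : L₀ ⊆ L
  closed : ∀ u ∈ S₀, ∀ v, s(u, v) ∈ L → s(u, v) ∈ L₀
  pos : 0 < S₀.card + L₀.card
  card_mod : (L₀.card + 2 * S₀.card) % 3 = 0
  decomposable : ∀ M, PathDecomposable M → PathDecomposable (M + cone a b S₀ L₀)
  decomposable_add_triangle : ∀ w, S \ S₀ = {w} →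
    PathDecomposable ({s(a, b)} + {s(a, w)} + {s(b, w)} + cone a b S₀ L₀)

/-- The induction step: removing a removable part leaves a smaller instance, except that the
instance left over may be a single vertex. -/
theorem Removable.pathDecomposable {S S₀ : Finset α} {L L₀ : Finset (Sym2 α)}
    (hr : Removable a b S L S₀ L₀)
    (h : IsGraphOn a b S L) (hmod : (L.card + 2 * S.card + 1) % 3 = 0)
    (ih : ∀ (S' : Finset α) (L' : Finset (Sym2 α)), S'.card + L'.card < S.card + L.card →
      IsGraphOn a b S' L' → (L'.card + 2 * S'.card + 1) % 3 = 0 → S'.card ≠ 1 →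
        PathDecomposable ({s(a, b)} + cone a b S' L')) :
    PathDecomposable ({s(a, b)} + cone a b S L) := by
  obtain ⟨hS, hL, hclosed, hpos, hmod₀, hdec, hexc⟩ := hr
  have hS' := Finset.card_sdiff_add_card_eq_card hS
  have hL' := Finset.card_sdiff_add_card_eq_card hL
  have hG : IsGraphOn a b (S \ S₀) (L \ L₀) := by
    refine ⟨fun ha => h.left_notMem (Finset.mem_sdiff.1 ha).1,
      fun hb => h.right_notMem (Finset.mem_sdiff.1 hb).1, ?_, ?_⟩
    · intro x y hxy
      rw [Finset.mem_sdiff] at hxy ⊢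
      exact ⟨h.mem_left hxy.1, fun hx => hxy.2 (hclosed x hx y hxy.1)⟩
    · intro x y hxy
      exact h.ne (Finset.mem_sdiff.1 hxy).1
  rw [← cone_sdiff hS hL, ← add_assoc]
  by_cases h1 : (S \ S₀).card = 1
  · -- A single vertex `w` carries no edges, so exactly the triangle `a b w` is left over.
    obtain ⟨w, hw⟩ := Finset.card_eq_one.1 h1
    have hempty : L \ L₀ = ∅ := by
      refine Finset.eq_empty_of_forall_notMem fun e => ?_
      induction e using Sym2.ind with
      | _ x y =>
        intro he
        have hx := hG.mem_left he
        have hy := hG.mem_right he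
        rw [hw, Finset.mem_singleton] at hx hy
        exact hG.ne he (hx.trans hy.symm)
    have := hexc w hw
    rw [hempty, hw]
    convert this using 1
    simp only [cone, Finset.sum_empty, Finset.sum_singleton]
    abel
  · exact hdec _ (ih _ _ (by omega) hG (by omega) h1)

end

/-! ### Explicit decompositions of small cones

Each decomposition is given by the list of its paths; the identity of edge multisets is then checked
after orienting every edge in the same way on both sides. -/

section

variable {α : Type*} [DecidableEq α] {a b : α}
variable {M : Multiset (Sym2 α)} {x y z w x' y' x'' y'' : α}

theorem decomposable_path (hd : [x, y, z, w].Nodup) (hM : PathDecomposable M) :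
    PathDecomposable (M + cone a b ∅ {s(x, y), s(y, z), s(z, w)}) := by
  convert hM.add x y z w (by grind) using 1
  simp only [List.nodup_cons, List.mem_cons, not_or] at hd
  unfold cone
  iterate 2 rw [Finset.sum_insert (by grind)]
  simp only [Finset.sum_singleton, Finset.sum_empty]
  abel

theorem decomposable_triangle (hd : [a, b, x, y, z].Nodup) (hM : PathDecomposable M) :
    PathDecomposable (M + cone a b {x, y, z} {s(x, y), s(y, z), s(x, z)}) := by
  convert ((hM.add a x y b (by grind)).add a y z b (by grind)).add a z x b (by grind) using 1
  simp only [List.nodup_cons, List.mem_cons, not_or] at hd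
  unfold cone
  iterate 4 rw [Finset.sum_insert (by grind)]
  rw [Sym2.eq_swap (a := y) (b := b),
    Sym2.eq_swap (a := z) (b := b),
    Sym2.eq_swap (a := z) (b := x),
    Sym2.eq_swap (a := x) (b := b)]
  simp only [Finset.sum_singleton]
  abel

theorem decomposable_triangle_add_triangle (hd : [a, b, x, y, z, w].Nodup) :
    PathDecomposable ({s(a, b)} + {s(a, w)} + {s(b, w)} +
        cone a b {x, y, z} {s(x, y), s(y, z), s(x, z)}) := by
  convert (((PathDecomposable.zero.add w a b x (by grind)).add w b y x (by grind)).add x a z b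
      (by grind)).add a y z x (by grind) using 1
  simp only [List.nodup_cons, List.mem_cons, not_or] at hd
  unfold cone
  iterate 4 rw [Finset.sum_insert (by grind)]
  rw [Sym2.eq_swap (a := w) (b := a),
    Sym2.eq_swap (a := w) (b := b),
    Sym2.eq_swap (a := y) (b := x),
    Sym2.eq_swap (a := x) (b := a),
    Sym2.eq_swap (a := z) (b := b),
    Sym2.eq_swap (a := z) (b := x)]
  simp only [Finset.sum_singleton]
  abel

/-- Two pendant edges `xy`, `xz` at a common vertex `x`: the edges at `y` and `z` form a
`K_{2,3}`. -/
theorem decomposable_leaves (hd : [a, b, x, y, z].Nodup) (hM : PathDecomposable M) :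
    PathDecomposable (M + cone a b {y, z} {s(x, y), s(x, z)}) := by
  convert (hM.add a y x z (by grind)).add a z b y (by grind) using 1
  simp only [List.nodup_cons, List.mem_cons, not_or] at hd
  unfold cone
  iterate 2 rw [Finset.sum_insert (by grind)]
  rw [Sym2.eq_swap (a := y) (b := x),
    Sym2.eq_swap (a := z) (b := b)]
  simp only [Finset.sum_singleton]
  abel

/-- Together with the triangle on `a`, `b`, `x` this is `K₅` without the edge `yz`. -/
theorem decomposable_leaves_add_triangle (hd : [a, b, x, y, z].Nodup) :
    PathDecomposable ({s(a, b)} + {s(a, x)} + {s(b, x)} + cone a b {y, z} {s(x, y), s(x, z)}) := by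
  convert ((PathDecomposable.zero.add y x a b (by grind)).add z x b y (by grind)).add y a z b
      (by grind) using 1
  simp only [List.nodup_cons, List.mem_cons, not_or] at hd
  unfold cone
  iterate 2 rw [Finset.sum_insert (by grind)]
  rw [Sym2.eq_swap (a := y) (b := x),
    Sym2.eq_swap (a := x) (b := a),
    Sym2.eq_swap (a := z) (b := x),
    Sym2.eq_swap (a := x) (b := b),
    Sym2.eq_swap (a := y) (b := a),
    Sym2.eq_swap (a := z) (b := b)]
  simp only [Finset.sum_singleton]
  abel

theorem decomposable_isolated (hd : [a, b, x, y, z].Nodup) (hM : PathDecomposable M) :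
    PathDecomposable (M + cone a b {x, y, z} ∅) := by
  convert (hM.add x a y b (by grind)).add x b z a (by grind) using 1
  simp only [List.nodup_cons, List.mem_cons, not_or] at hd
  unfold cone
  iterate 2 rw [Finset.sum_insert (by grind)]
  rw [Sym2.eq_swap (a := x) (b := a),
    Sym2.eq_swap (a := y) (b := b),
    Sym2.eq_swap (a := x) (b := b),
    Sym2.eq_swap (a := z) (b := a)]
  simp only [Finset.sum_singleton, Finset.sum_empty]
  abel

theorem decomposable_isolated_add_triangle (hd : [a, b, x, y, z, w].Nodup) :
    PathDecomposable ({s(a, b)} + {s(a, w)} + {s(b, w)} + cone a b {x, y, z} ∅) := by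
  convert ((PathDecomposable.zero.add x a b y (by grind)).add x b z a (by grind)).add y a w b
      (by grind) using 1
  simp only [List.nodup_cons, List.mem_cons, not_or] at hd
  unfold cone
  iterate 2 rw [Finset.sum_insert (by grind)]
  rw [Sym2.eq_swap (a := x) (b := a),
    Sym2.eq_swap (a := x) (b := b),
    Sym2.eq_swap (a := z) (b := a),
    Sym2.eq_swap (a := y) (b := a),
    Sym2.eq_swap (a := w) (b := b)]
  simp only [Finset.sum_singleton, Finset.sum_empty]
  abel

theorem decomposable_edge_isolated (hd : [a, b, x, y, z, w].Nodup) (hM : PathDecomposable M) :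
    PathDecomposable (M + cone a b {x, y, z, w} {s(x, y)}) := by
  convert ((hM.add a x y b (by grind)).add y a z b (by grind)).add x b w a (by grind) using 1
  simp only [List.nodup_cons, List.mem_cons, not_or] at hd
  unfold cone
  iterate 3 rw [Finset.sum_insert (by grind)]
  rw [Sym2.eq_swap (a := y) (b := b),
    Sym2.eq_swap (a := y) (b := a),
    Sym2.eq_swap (a := z) (b := b),
    Sym2.eq_swap (a := x) (b := b),
    Sym2.eq_swap (a := w) (b := a)]
  simp only [Finset.sum_singleton]
  abel

theorem decomposable_two_edges_isolated (hd : [a, b, x, y, x', y', z].Nodup)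
    (hM : PathDecomposable M) :
    PathDecomposable (M + cone a b {x, y, x', y', z} {s(x, y), s(x', y')}) := by
  convert (((hM.add x y a x' (by grind)).add x' y' b y (by grind)).add y' a z b
      (by grind)).add a x b x' (by grind) using 1
  simp only [List.nodup_cons, List.mem_cons, not_or] at hd
  unfold cone
  iterate 5 rw [Finset.sum_insert (by grind)]
  rw [Sym2.eq_swap (a := y) (b := a),
    Sym2.eq_swap (a := y') (b := b),
    Sym2.eq_swap (a := y') (b := a),
    Sym2.eq_swap (a := z) (b := b),
    Sym2.eq_swap (a := x) (b := b)]
  simp only [Finset.sum_singleton]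
  abel

theorem decomposable_three_edges (hd : [a, b, x, y, x', y', x'', y''].Nodup)
    (hM : PathDecomposable M) :
    PathDecomposable (M + cone a b {x, y, x', y', x'', y''} {s(x, y), s(x', y'), s(x'', y'')}) := by
  convert ((((hM.add a x b x' (by grind)).add b x'' a y (by grind)).add x y b y''
      (by grind)).add x'' y'' a y' (by grind)).add a x' y' b (by grind) using 1
  simp only [List.nodup_cons, List.mem_cons, not_or] at hd
  unfold cone
  iterate 7 rw [Finset.sum_insert (by grind)]
  rw [Sym2.eq_swap (a := x) (b := b),
    Sym2.eq_swap (a := x'') (b := a),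
    Sym2.eq_swap (a := y) (b := b),
    Sym2.eq_swap (a := y'') (b := a),
    Sym2.eq_swap (a := y') (b := b)]
  simp only [Finset.sum_singleton]
  abel

theorem decomposable_edge (hd : [a, b, x, y].Nodup) :
    PathDecomposable ({s(a, b)} + cone a b {x, y} {s(x, y)}) := by
  convert (PathDecomposable.zero.add x a b y (by grind)).add a y x b (by grind) using 1
  simp only [List.nodup_cons, List.mem_cons, not_or] at hd
  unfold cone
  iterate 1 rw [Finset.sum_insert (by grind)]
  rw [Sym2.eq_swap (a := x) (b := a),
    Sym2.eq_swap (a := y) (b := x),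
    Sym2.eq_swap (a := x) (b := b)]
  simp only [Finset.sum_singleton]
  abel

end

/-! ### Finding removable parts -/

section

variable {α : Type*} {a b : α} {S : Finset α} {L : Finset (Sym2 α)}

namespace IsGraphOn

theorem nodup_cons_cons (h : IsGraphOn a b S L) (hab : a ≠ b) {l : List α} (hl : l.Nodup)
    (hlS : ∀ x ∈ l, x ∈ S) : (a :: b :: l).Nodup := by
  rw [List.nodup_cons, List.nodup_cons, List.mem_cons, not_or]
  exact ⟨⟨hab, fun hx => h.left_notMem (hlS a hx)⟩, fun hx => h.right_notMem (hlS b hx), hl⟩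

variable [DecidableEq α]

theorem removable_path (h1 : S.card ≠ 1) {x y z w : α}
    (hd : [x, y, z, w].Nodup) (hxy : s(x, y) ∈ L) (hyz : s(y, z) ∈ L) (hzw : s(z, w) ∈ L) :
    Removable a b S L ∅ {s(x, y), s(y, z), s(z, w)} := by
  have hc : ({s(x, y), s(y, z), s(z, w)} : Finset (Sym2 α)).card = 3 :=
    Finset.card_eq_three.2 ⟨_, _, _, by grind, by grind, by grind, rfl⟩
  refine ⟨by simp, by simp [Finset.insert_subset_iff, *], by simp, by simp, by simp [hc],
    fun M hM => decomposable_path hd hM, fun u hu => ?_⟩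
  exact absurd (by simpa using congrArg Finset.card hu) h1

/-- In a graph without `P₄`, every triangle is a component. -/
theorem removable_triangle (h : IsGraphOn a b S L) (hab : a ≠ b)
    (hP : ∀ x y z w, s(x, y) ∈ L → s(y, z) ∈ L → s(z, w) ∈ L → x ≠ z → y ≠ w → x = w)
    {x y z : α} (hxy : s(x, y) ∈ L) (hyz : s(y, z) ∈ L) (hxz : s(x, z) ∈ L) :
    Removable a b S L {x, y, z} {s(x, y), s(y, z), s(x, z)} := by
  have hyx : s(y, x) ∈ L := Sym2.eq_swap ▸ hxy
  have hzx : s(z, x) ∈ L := Sym2.eq_swap ▸ hxz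
  have nxy := h.ne hxy
  have nyz := h.ne hyz
  have nxz := h.ne hxz
  have hx := h.mem_left hxy
  have hy := h.mem_left hyz
  have hz := h.mem_right hyz
  have hd : [x, y, z].Nodup := by simp [*]
  have hc : ({s(x, y), s(y, z), s(x, z)} : Finset (Sym2 α)).card = 3 :=
    Finset.card_eq_three.2 ⟨_, _, _, by grind, by grind, by grind, rfl⟩
  have hc' : ({x, y, z} : Finset α).card = 3 := Finset.card_eq_three.2 ⟨_, _, _, nxy, nxz, nyz, rfl⟩
  -- A further edge `pv` at a vertex `p` of the triangle would give the path `v p q r`.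
  have key : ∀ p q r v, s(p, q) ∈ L → s(q, r) ∈ L → p ≠ r → s(p, v) ∈ L →
      v = q ∨ v = r := by
    intro p q r v hpq hqr hpr hpv
    by_contra! hv
    exact hv.2 (hP v p q r (Sym2.eq_swap ▸ hpv) hpq hqr hv.1 hpr)
  refine ⟨by simp [Finset.insert_subset_iff, *], by simp [Finset.insert_subset_iff, *], ?_,
    by omega, by omega,
    fun M hM => decomposable_triangle (h.nodup_cons_cons hab hd (by simp [*])) hM, fun w hw => ?_⟩
  · intro u hu v huv
    simp only [Finset.mem_insert, Finset.mem_singleton] at hu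
    rcases hu with rfl | rfl | rfl
    · rcases key u y z v hxy hyz nxz huv with rfl | rfl <;> simp
    · rcases key u x z v hyx hxz nyz huv with rfl | rfl <;> simp
    · rcases key u x y v hzx hxy nyz.symm huv with rfl | rfl <;> simp
  · have hw' : w ∈ S \ {x, y, z} := by simp [hw]
    simp only [Finset.mem_sdiff, Finset.mem_insert, Finset.mem_singleton, not_or] at hw'
    exact decomposable_triangle_add_triangle
      (h.nodup_cons_cons hab (by simp [*, Ne.symm hw'.2.1, Ne.symm hw'.2.2.1, Ne.symm hw'.2.2.2])
        (by simp [*]))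

/-- In a graph without `P₄` and triangles, all neighbours of a vertex of degree at least two are
leaves. If the center `x` is all that remains, it is the vertex of the exceptional triangle. -/
theorem removable_leaves (h : IsGraphOn a b S L) (hab : a ≠ b)
    (hP : ∀ x y z w, s(x, y) ∈ L → s(y, z) ∈ L → s(z, w) ∈ L → x ≠ z → y ≠ w → x = w)
    (hT : ∀ x y z, s(x, y) ∈ L → s(y, z) ∈ L → s(x, z) ∉ L)
    {x y z : α} (hyz : y ≠ z) (hxy : s(x, y) ∈ L) (hxz : s(x, z) ∈ L) :
    Removable a b S L {y, z} {s(x, y), s(x, z)} := by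
  have nxy := h.ne hxy
  have nxz := h.ne hxz
  have hx := h.mem_left hxy
  have hy := h.mem_right hxy
  have hz := h.mem_right hxz
  have hd : [a, b, x, y, z].Nodup := h.nodup_cons_cons hab (by simp [*]) (by simp [*])
  have hc : ({s(x, y), s(x, z)} : Finset (Sym2 α)).card = 2 := Finset.card_pair (by grind)
  have hc' : ({y, z} : Finset α).card = 2 := Finset.card_pair hyz
  -- A further edge `pv` would give the path `v p x q`, or a triangle if `v = q`.
  have key : ∀ p q v, p ≠ q → s(x, p) ∈ L → s(x, q) ∈ L → s(p, v) ∈ L → v = x := by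
    intro p q v hpq hp hq hpv
    by_contra hv
    obtain rfl := hP v p x q (Sym2.eq_swap ▸ hpv) (Sym2.eq_swap ▸ hp) hq hv hpq
    exact hT x p v hp hpv hq
  refine ⟨by simp [Finset.insert_subset_iff, *], by simp [Finset.insert_subset_iff, *], ?_,
    by omega, by omega, fun M hM => decomposable_leaves hd hM, fun w hw => ?_⟩
  · intro u hu v huv
    simp only [Finset.mem_insert, Finset.mem_singleton] at hu
    rcases hu with rfl | rfl
    · rw [key u z v hyz hxy hxz huv, Sym2.eq_swap]; simp
    · rw [key u y v hyz.symm hxz hxy huv, Sym2.eq_swap]; simp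
  · have : x ∈ S \ {y, z} := by
      rw [Finset.mem_sdiff]
      exact ⟨hx, by simp [nxy, nxz]⟩
    rw [hw, Finset.mem_singleton] at this
    subst this
    exact decomposable_leaves_add_triangle hd

theorem removable_isolated (h : IsGraphOn a b S L) (hab : a ≠ b) {x y z : α}
    (hd : [x, y, z].Nodup) (hx : x ∈ S) (hy : y ∈ S) (hz : z ∈ S)
    (hx' : ∀ v, s(x, v) ∉ L) (hy' : ∀ v, s(y, v) ∉ L) (hz' : ∀ v, s(z, v) ∉ L) :
    Removable a b S L {x, y, z} ∅ := by
  have hc' : ({x, y, z} : Finset α).card = 3 := by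
    simpa using List.toFinset_card_of_nodup hd
  refine ⟨by simp [Finset.insert_subset_iff, *], by simp, by simp [*],
    by omega, by simp [hc'],
    fun M hM => decomposable_isolated (h.nodup_cons_cons hab hd (by simp [*])) hM, fun w hw => ?_⟩
  have hw' : w ∈ S \ {x, y, z} := by simp [hw]
  refine decomposable_isolated_add_triangle
      (h.nodup_cons_cons hab (by grind) (by grind))

/-! ### Removable parts of matchings -/

/-- A graph in which distinct edges are disjoint has `2 |L|` vertices besides the isolated ones. -/
theorem card_eq_of_matching (h : IsGraphOn a b S L)
    (hm : ∀ u, ∀ e ∈ L, ∀ f ∈ L, u ∈ e → u ∈ f → e = f) (I : Finset α)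
    (hI : ∀ x, x ∈ I ↔ x ∈ S ∧ ∀ y, s(x, y) ∉ L) : S.card = I.card + 2 * L.card := by
  have hIS : I ⊆ S := fun x hx => ((hI x).1 hx).1
  have hunion : S \ I = L.biUnion Sym2.toFinset := by
    ext x
    simp only [Finset.mem_sdiff, hI, Finset.mem_biUnion, Sym2.mem_toFinset, not_forall, not_not,
      not_and]
    constructor
    · rintro ⟨hx, hy⟩
      obtain ⟨y, hy⟩ := hy hx
      exact ⟨_, hy, Sym2.mem_mk_left x y⟩
    · rintro ⟨e, he, y, rfl⟩
      exact ⟨h.mem_left he, fun _ => ⟨y, he⟩⟩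
  have hcard : (L.biUnion Sym2.toFinset).card = 2 * L.card := by
    rw [Finset.card_biUnion, Finset.sum_const_nat (m := 2), mul_comm]
    · intro e
      induction e using Sym2.ind with
      | _ x y => exact fun he => Sym2.card_toFinset_of_not_isDiag _ (h.ne he)
    · intro e he f hf hef
      refine Finset.disjoint_left.2 fun x hxe hxf => hef ?_
      exact hm x e he f hf (Sym2.mem_toFinset.1 hxe) (Sym2.mem_toFinset.1 hxf)
  rw [← hcard, ← hunion, add_comm, Finset.card_sdiff_add_card_eq_card hIS]

omit [DecidableEq α] in
theorem ne_of_matching (hm : ∀ u, ∀ e ∈ L, ∀ f ∈ L, u ∈ e → u ∈ f → e = f) {p q r t : α}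
    (hpq : s(p, q) ∈ L) (hrt : s(r, t) ∈ L) (hn : s(p, q) ≠ s(r, t)) :
    p ≠ r ∧ p ≠ t ∧ q ≠ r ∧ q ≠ t := by
  refine ⟨?_, ?_, ?_, ?_⟩
  all_goals rintro rfl
  · exact hn (hm p _ hpq _ hrt (by simp) (by simp))
  · exact hn (hm p _ hpq _ hrt (by simp) (by simp))
  · exact hn (hm q _ hpq _ hrt (by simp) (by simp))
  · exact hn (hm q _ hpq _ hrt (by simp) (by simp))

/-- Here and in the next two lemmas a hypothesis on `|S|` excludes that a single vertex is left over.
In a matching that vertex would be one more isolated vertex, so another part is removable. -/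
theorem removable_edge_isolated (h : IsGraphOn a b S L)
    (hm : ∀ u, ∀ e ∈ L, ∀ f ∈ L, u ∈ e → u ∈ f → e = f) (hab : a ≠ b) (h5 : S.card ≠ 5)
    {x y z w : α} (hxy : s(x, y) ∈ L) (hzw : z ≠ w) (hz : z ∈ S) (hw : w ∈ S)
    (hz' : ∀ v, s(z, v) ∉ L) (hw' : ∀ v, s(w, v) ∉ L) :
    Removable a b S L {x, y, z, w} {s(x, y)} := by
  have nxy := h.ne hxy
  have hx := h.mem_left hxy
  have hy := h.mem_right hxy
  have hyx : s(y, x) ∈ L := Sym2.eq_swap ▸ hxy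
  have hd : [x, y, z, w].Nodup := by
    simp only [List.nodup_cons, List.mem_cons, List.not_mem_nil, or_false, not_or]
    refine ⟨⟨nxy, ?_, ?_⟩, ⟨?_, ?_⟩, hzw, by simp⟩
    all_goals rintro rfl
    exacts [hz' _ hxy, hw' _ hxy, hz' _ hyx, hw' _ hyx]
  have hc : ({x, y, z, w} : Finset α).card = 4 := by simpa using List.toFinset_card_of_nodup hd
  have hs : ({x, y, z, w} : Finset α) ⊆ S := by simp [Finset.insert_subset_iff, *]
  refine ⟨hs, by simpa, ?_, by omega, by simp [hc],
    fun M hM => decomposable_edge_isolated (h.nodup_cons_cons hab hd (by simp [*])) hM,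
    fun u hu => ?_⟩
  · intro u hu v huv
    simp only [Finset.mem_insert, Finset.mem_singleton] at hu ⊢
    rcases hu with rfl | rfl | rfl | rfl
    · exact hm u _ huv _ hxy (by simp) (by simp)
    · exact hm u _ huv _ hxy (by simp) (by simp)
    · exact absurd huv (hz' v)
    · exact absurd huv (hw' v)
  · have := Finset.card_sdiff_add_card_eq_card hs
    rw [hu, Finset.card_singleton] at this
    omega

theorem removable_two_edges_isolated (h : IsGraphOn a b S L)
    (hm : ∀ u, ∀ e ∈ L, ∀ f ∈ L, u ∈ e → u ∈ f → e = f) (hab : a ≠ b) (h6 : S.card ≠ 6)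
    {x y x' y' z : α} (hxy : s(x, y) ∈ L) (hxy' : s(x', y') ∈ L) (hne : s(x, y) ≠ s(x', y'))
    (hz : z ∈ S) (hz' : ∀ v, s(z, v) ∉ L) :
    Removable a b S L {x, y, x', y', z} {s(x, y), s(x', y')} := by
  have nxy := h.ne hxy
  have hx := h.mem_left hxy
  have hy := h.mem_right hxy
  have nxy' := h.ne hxy'
  have hx' := h.mem_left hxy'
  have hy' := h.mem_right hxy'
  have hd : [x, y, x', y', z].Nodup := by
    obtain ⟨_, _, _, _⟩ := ne_of_matching hm hxy hxy' hne
    have key : ∀ u v, s(u, v) ∈ L → u ≠ z ∧ v ≠ z := fun u v huv =>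
      ⟨fun e => hz' v (e ▸ huv), fun e => hz' u (Sym2.eq_swap ▸ e ▸ huv)⟩
    simp [*, key _ _ hxy, key _ _ hxy']
  have hc : ({x, y, x', y', z} : Finset α).card = 5 := by
    simpa using List.toFinset_card_of_nodup hd
  have hc' : ({s(x, y), s(x', y')} : Finset (Sym2 α)).card = 2 := Finset.card_pair hne
  have hs : ({x, y, x', y', z} : Finset α) ⊆ S := by simp [Finset.insert_subset_iff, *]
  refine ⟨hs, by simp [Finset.insert_subset_iff, *], ?_, by omega, by omega,
    fun M hM => decomposable_two_edges_isolated (h.nodup_cons_cons hab hd (by simp [*])) hM,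
    fun u hu => ?_⟩
  · intro u hu v huv
    simp only [Finset.mem_insert, Finset.mem_singleton] at hu ⊢
    rcases hu with rfl | rfl | rfl | rfl | rfl
    · exact .inl (hm u _ huv _ hxy (by simp) (by simp))
    · exact .inl (hm u _ huv _ hxy (by simp) (by simp))
    · exact .inr (hm u _ huv _ hxy' (by simp) (by simp))
    · exact .inr (hm u _ huv _ hxy' (by simp) (by simp))
    · exact absurd huv (hz' v)
  · have := Finset.card_sdiff_add_card_eq_card hs
    rw [hu, Finset.card_singleton] at this
    omega

theorem removable_three_edges (h : IsGraphOn a b S L)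
    (hm : ∀ u, ∀ e ∈ L, ∀ f ∈ L, u ∈ e → u ∈ f → e = f) (hab : a ≠ b) (h7 : S.card ≠ 7)
    {x y x' y' x'' y'' : α} (hxy : s(x, y) ∈ L) (hxy' : s(x', y') ∈ L) (hxy'' : s(x'', y'') ∈ L)
    (hne : s(x, y) ≠ s(x', y')) (hne' : s(x, y) ≠ s(x'', y''))
    (hne'' : s(x', y') ≠ s(x'', y'')) :
    Removable a b S L {x, y, x', y', x'', y''} {s(x, y), s(x', y'), s(x'', y'')} := by
  have hx := h.mem_left hxy
  have hy := h.mem_right hxy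
  have hx' := h.mem_left hxy'
  have hy' := h.mem_right hxy'
  have hx'' := h.mem_left hxy''
  have hy'' := h.mem_right hxy''
  have hd : [x, y, x', y', x'', y''].Nodup := by
    obtain ⟨_, _, _, _⟩ := ne_of_matching hm hxy hxy' hne
    obtain ⟨_, _, _, _⟩ := ne_of_matching hm hxy hxy'' hne'
    obtain ⟨_, _, _, _⟩ := ne_of_matching hm hxy' hxy'' hne''
    simp [*, h.ne hxy, h.ne hxy', h.ne hxy'']
  have hc : ({x, y, x', y', x'', y''} : Finset α).card = 6 := by
    simpa using List.toFinset_card_of_nodup hd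
  have hc' : ({s(x, y), s(x', y'), s(x'', y'')} : Finset (Sym2 α)).card = 3 :=
    Finset.card_eq_three.2 ⟨_, _, _, hne, hne', hne'', rfl⟩
  have hs : ({x, y, x', y', x'', y''} : Finset α) ⊆ S := by simp [Finset.insert_subset_iff, *]
  refine ⟨hs, by simp [Finset.insert_subset_iff, *], ?_, by omega, by omega,
    fun M hM => decomposable_three_edges (h.nodup_cons_cons hab hd (by simp [*])) hM,
    fun u hu => ?_⟩
  · intro u hu v huv
    simp only [Finset.mem_insert, Finset.mem_singleton] at hu ⊢
    rcases hu with rfl | rfl | rfl | rfl | rfl | rfl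
    · exact .inl (hm u _ huv _ hxy (by simp) (by simp))
    · exact .inl (hm u _ huv _ hxy (by simp) (by simp))
    · exact .inr (.inl (hm u _ huv _ hxy' (by simp) (by simp)))
    · exact .inr (.inl (hm u _ huv _ hxy' (by simp) (by simp)))
    · exact .inr (.inr (hm u _ huv _ hxy'' (by simp) (by simp)))
    · exact .inr (.inr (hm u _ huv _ hxy'' (by simp) (by simp)))
  · have := Finset.card_sdiff_add_card_eq_card hs
    rw [hu, Finset.card_singleton] at this
    omega

end IsGraphOn

end

/-! ### Decomposing the join of a graph with an edge -/

section

variable {α : Type*} [DecidableEq α] {a b : α} {S : Finset α} {L : Finset (Sym2 α)}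

/-- A graph admitting none of the seven removals has no `P₄`, no triangle and no vertex of degree
two, so it is a matching with at most two isolated vertices; the congruence then leaves only a
single edge, whose cone together with `ab` is `K₄`. -/
theorem IsGraphOn.exists_removable (h : IsGraphOn a b S L) (hab : a ≠ b)
    (hmod : (L.card + 2 * S.card + 1) % 3 = 0) (h1 : S.card ≠ 1) :
    (∃ S₀ L₀, Removable a b S L S₀ L₀) ∨ (L.card = 1 ∧ S.card = 2) := by
  by_contra! hno
  obtain ⟨hno, hbase⟩ := hno
  have hP : ∀ x y z w, s(x, y) ∈ L → s(y, z) ∈ L → s(z, w) ∈ L → x ≠ z → y ≠ w → x = w := by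
    intro x y z w hxy hyz hzw hxz hyw
    by_contra hxw
    exact hno _ _ (removable_path h1 (by simp [h.ne hxy, h.ne hyz, h.ne hzw, *]) hxy hyz hzw)
  have hT : ∀ x y z, s(x, y) ∈ L → s(y, z) ∈ L → s(x, z) ∉ L := fun x y z hxy hyz hxz =>
    hno _ _ (h.removable_triangle hab hP hxy hyz hxz)
  have hm : ∀ u, ∀ e ∈ L, ∀ f ∈ L, u ∈ e → u ∈ f → e = f := by
    rintro u _ he _ hf ⟨y, rfl⟩ ⟨z, rfl⟩
    by_contra hyz
    exact hno _ _ (h.removable_leaves hab hP hT (fun e => hyz (by rw [e])) he hf)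
  classical
  -- `I` is the set of isolated vertices of the matching `L`.
  let I := S.filter fun x => ∀ y, s(x, y) ∉ L
  have hI : ∀ x, x ∈ I ↔ x ∈ S ∧ ∀ y, s(x, y) ∉ L := fun x => Finset.mem_filter
  have hcard := h.card_eq_of_matching hm I hI
  clear_value I
  have hI3 : I.card < 3 := by
    by_contra! hI3
    obtain ⟨x, hx, y, hy, z, hz, hxy, hxz, hyz⟩ := Finset.two_lt_card.1 hI3
    rw [hI] at hx hy hz
    exact hno _ _ (h.removable_isolated hab (by simp [*]) hx.1 hy.1 hz.1 hx.2 hy.2 hz.2)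
  have hI2 : ¬ (I.card = 2 ∧ 1 ≤ L.card) := by
    rintro ⟨hI2, hL1⟩
    obtain ⟨z, hz, w, hw, hzw⟩ := Finset.one_lt_card.1 (show 1 < I.card by omega)
    obtain ⟨e, he⟩ := Finset.card_pos.1 hL1
    rw [hI] at hz hw
    induction e using Sym2.ind with
    | _ x y =>
      exact hno _ _ (h.removable_edge_isolated hm hab (by omega) he hzw hz.1 hw.1 hz.2 hw.2)
  have hI1 : ¬ (I.card = 1 ∧ 2 ≤ L.card) := by
    rintro ⟨hI1, hL2⟩
    obtain ⟨z, hz⟩ := Finset.card_pos.1 (show 0 < I.card by omega)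
    obtain ⟨e, he, f, hf, hef⟩ := Finset.one_lt_card.1 hL2
    rw [hI] at hz
    induction e using Sym2.ind with
    | _ x y =>
      induction f using Sym2.ind with
      | _ x' y' =>
        exact hno _ _ (h.removable_two_edges_isolated hm hab (by omega) he hf hef hz.1 hz.2)
  have hI0 : ¬ (I.card = 0 ∧ 3 ≤ L.card) := by
    rintro ⟨hI0, hL3⟩
    obtain ⟨e, he, f, hf, g, hg, hef, heg, hfg⟩ := Finset.two_lt_card.1 hL3
    induction e using Sym2.ind with
    | _ x y =>
      induction f using Sym2.ind with
      | _ x' y' =>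
        induction g using Sym2.ind with
        | _ x'' y'' =>
          exact hno _ _ (h.removable_three_edges hm hab (by omega) he hf hg hef heg hfg)
  have hL2 : L.card ≤ 2 := by omega
  interval_cases L.card <;> omega

/-- The join of an arbitrary graph with `K₂` is `P₄`-decomposable as soon as its number of edges is
divisible by three, unless it is a triangle. -/
theorem IsGraphOn.pathDecomposable (h : IsGraphOn a b S L) (hab : a ≠ b)
    (hmod : (L.card + 2 * S.card + 1) % 3 = 0) (h1 : S.card ≠ 1) :
    PathDecomposable ({s(a, b)} + cone a b S L) := by
  induction hn : S.card + L.card using Nat.strong_induction_on generalizing S L with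
  | _ n ih =>
  subst hn
  obtain ⟨S₀, L₀, hr⟩ | ⟨hL1, hS2⟩ := h.exists_removable hab hmod h1
  · exact hr.pathDecomposable h hmod fun S' L' hlt h' hmod' h1' => ih _ hlt h' hmod' h1' rfl
  · obtain ⟨e, rfl⟩ := Finset.card_eq_one.1 hL1
    induction e using Sym2.ind with
    | _ x y =>
    have he : s(x, y) ∈ ({s(x, y)} : Finset (Sym2 α)) := Finset.mem_singleton_self _
    have hx := h.mem_left he
    have hy := h.mem_right he
    obtain rfl : {x, y} = S := Finset.eq_of_subset_of_card_le
      (by simp [Finset.insert_subset_iff, *]) (by rw [hS2, Finset.card_pair (h.ne he)])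
    exact decomposable_edge (h.nodup_cons_cons hab (by simp [h.ne he]) (by simp))

/-! ### From edge multisets to designs -/

omit [DecidableEq α] in
theorem cone_eq (a b : α) (S : Finset α) (L : Finset (Sym2 α)) :
    cone a b S L = L.val + (S.val.map (fun x => s(a, x)) + S.val.map fun x => s(b, x)) := by
  have key : ∀ c : α, ∑ x ∈ S, ({s(c, x)} : Multiset (Sym2 α)) = S.val.map fun x => s(c, x) := by
    intro c
    rw [Finset.sum, ← Multiset.sum_map_singleton (S.val.map fun x => s(c, x)), Multiset.map_map]
    rfl
  rw [cone, Finset.sum_multiset_singleton, Finset.sum_add_distrib, key, key]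

omit [DecidableEq α] in
theorem mem_singleton_add_cone {e : Sym2 α} :
    e ∈ {s(a, b)} + cone a b S L ↔
      e = s(a, b) ∨ e ∈ L ∨ (∃ x ∈ S, s(a, x) = e) ∨ ∃ x ∈ S, s(b, x) = e := by
  simp [cone_eq]

omit [DecidableEq α] in
theorem IsGraphOn.nodup_singleton_add_cone (h : IsGraphOn a b S L) (hab : a ≠ b) :
    ({s(a, b)} + cone a b S L).Nodup := by
  have ha := h.left_notMem
  have hb := h.right_notMem
  have hinj : ∀ c : α, (S.val.map fun x => s(c, x)).Nodup := fun c =>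
    S.nodup.map fun x y hxy => Sym2.congr_right.1 hxy
  rw [cone_eq, Multiset.nodup_add, Multiset.nodup_add, Multiset.nodup_add]
  refine ⟨by simp, ⟨L.nodup, ⟨hinj a, hinj b, ?_⟩, ?_⟩, ?_⟩
  · rw [Multiset.disjoint_left]
    simp only [Multiset.mem_map, Finset.mem_val]
    rintro _ ⟨x, hx, rfl⟩ ⟨y, hy, he⟩
    rw [Sym2.eq_iff] at he
    rcases he with ⟨rfl, -⟩ | ⟨rfl, -⟩
    exacts [hab rfl, hb hx]
  · rw [Multiset.disjoint_left]
    simp only [Multiset.mem_map, Multiset.mem_add, Finset.mem_val]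
    rintro _ he (⟨x, -, rfl⟩ | ⟨x, -, rfl⟩)
    exacts [ha (h.mem_left he), hb (h.mem_left he)]
  · rw [Multiset.disjoint_left]
    simp only [Multiset.mem_map, Multiset.mem_add, Finset.mem_val, Multiset.mem_singleton]
    rintro _ rfl (he | ⟨x, hx, he⟩ | ⟨x, hx, he⟩)
    · exact ha (h.mem_left he)
    · obtain rfl := Sym2.congr_right.1 he
      exact hb hx
    · rw [Sym2.eq_swap, Sym2.congr_left] at he
      exact ha (he ▸ hx)

omit [DecidableEq α] in
theorem card_singleton_add_cone :
    ({s(a, b)} + cone a b S L).card = L.card + 2 * S.card + 1 := by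
  simp [cone_eq]
  ring

omit [DecidableEq α] in
theorem IsPartialDesign.three_dvd_ncard [Finite α] {G : SimpleGraph α} {B : Set G.Subgraph}
    (hB : IsPartialDesign G (pathGraph 4) B) : 3 ∣ (⋃ H ∈ B, H.edgeSet).ncard := by
  classical
  have := Fintype.ofFinite α
  have : (⋃ H ∈ B, H.edgeSet) =
      ((B.toFinite.toFinset.biUnion fun H => H.edgeSet.toFinset : Finset (Sym2 α)) : Set _) := by
    ext; simp
  rw [this, Set.ncard_coe_finset, Finset.card_biUnion, Finset.sum_const_nat (m := 3)]
  · exact Dvd.intro_left _ rfl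
  · intro H hH
    rw [← Set.ncard_eq_toFinset_card']
    exact ncard_edgeSet_of_iso (hB.1 H (by simpa using hH))
  · intro H hH K hK hHK
    exact Set.disjoint_toFinset.2 (hB.2 (by simpa using hH) (by simpa using hK) hHK)

omit [DecidableEq α] in
theorem IsPartialDesign.map {β U : Type*} {G : SimpleGraph α} {G' : SimpleGraph β}
    {Γ : SimpleGraph U} {B : Set G.Subgraph} (hB : IsPartialDesign G Γ B) (φ : Copy G G') :
    IsPartialDesign G' Γ ((fun H => H.map φ.toHom) '' B) := by
  refine ⟨?_, ?_⟩
  · rintro _ ⟨H, hH, rfl⟩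
    obtain ⟨e⟩ := hB.1 H hH
    exact ⟨e.comp (φ.isoSubgraphMap H).symm⟩
  · rintro _ ⟨H, hH, rfl⟩ _ ⟨K, hK, rfl⟩ hne
    have := hB.2 hH hK fun e => hne (by rw [e])
    simp only [Function.onFun, Subgraph.edgeSet_map] at this ⊢
    exact Set.disjoint_image_of_injective (Sym2.map.injective φ.injective) this

omit [DecidableEq α] in
/-- A partial design that leaves two vertices `a` and `b` unused can be completed on the same vertex
set. -/
theorem IsPartialDesign.exists_isDesign [Fintype α] (hab : a ≠ b)
    {B : Set (completeGraph α).Subgraph}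
    (hB : IsPartialDesign (completeGraph α) (pathGraph 4) B)
    (ha : ∀ H ∈ B, a ∉ H.verts) (hb : ∀ H ∈ B, b ∉ H.verts)
    (hdvd : 3 ∣ (Fintype.card α).choose 2) (h3 : Fintype.card α ≠ 3) :
    ∃ B', B ⊆ B' ∧ IsDesign (completeGraph α) (pathGraph 4) B' := by
  classical
  let U : Set (Sym2 α) := ⋃ H ∈ B, H.edgeSet
  have hUE : U ⊆ (completeGraph α).edgeSet := Set.iUnion₂_subset fun H _ => H.edgeSet_subset
  have hUdvd : 3 ∣ U.ncard := hB.three_dvd_ncard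
  have hU : ∀ c, (∀ H ∈ B, c ∉ H.verts) → ∀ e ∈ U, c ∉ e := by
    intro c hc e he hce
    obtain ⟨H, hH, he⟩ := Set.mem_iUnion₂.1 he
    exact hc H hH (Subgraph.mem_verts_of_mem_edge he hce)
  have hUa := hU a ha
  have hUb := hU b hb
  -- The edges to be decomposed form the join of `(S, L)` with the edge `ab`.
  let S : Finset α := Finset.univ \ {a, b}
  let L : Finset (Sym2 α) := Finset.univ.filter fun e => ¬ e.IsDiag ∧ a ∉ e ∧ b ∉ e ∧ e ∉ U
  have hmemS : ∀ x, x ∈ S ↔ x ≠ a ∧ x ≠ b := by simp [S]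
  have hmemL : ∀ x y, s(x, y) ∈ L ↔ x ≠ y ∧ (a ≠ x ∧ a ≠ y) ∧ (b ≠ x ∧ b ≠ y) ∧ s(x, y) ∉ U := by
    simp [L]
  have hScard : S.card + 2 = Fintype.card α := by
    rw [← Finset.card_pair hab, Finset.card_sdiff_add_card_eq_card (Finset.subset_univ _),
      Finset.card_univ]
  have hG : IsGraphOn a b S L := by
    refine ⟨by simp [S], by simp [S], fun {x y} hxy => ?_, fun {x y} hxy => ((hmemL x y).1 hxy).1⟩
    obtain ⟨-, h, h', -⟩ := (hmemL x y).1 hxy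
    exact (hmemS x).2 ⟨h.1.symm, h'.1.symm⟩
  have hnodup := hG.nodup_singleton_add_cone hab
  have hset : {e | e ∈ {s(a, b)} + cone a b S L} = (completeGraph α).edgeSet \ U := by
    ext e
    rw [Set.mem_ofPred_eq, mem_singleton_add_cone]
    constructor
    · rintro (rfl | he | ⟨x, hx, rfl⟩ | ⟨x, hx, rfl⟩)
      · exact ⟨hab, fun he => hUa _ he (Sym2.mem_mk_left _ _)⟩
      · induction e using Sym2.ind with
        | _ x y =>
          obtain ⟨hxy, -, -, hU⟩ := (hmemL x y).1 he
          exact ⟨hxy, hU⟩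
      · exact ⟨((hmemS x).1 hx).1.symm, fun he => hUa _ he (Sym2.mem_mk_left _ _)⟩
      · exact ⟨((hmemS x).1 hx).2.symm, fun he => hUb _ he (Sym2.mem_mk_left _ _)⟩
    · rintro ⟨hK, heU⟩
      by_cases hae : a ∈ e
      · obtain ⟨y, rfl⟩ := hae
        by_cases hyb : y = b
        · exact .inl (by rw [hyb])
        · exact .inr (.inr (.inl ⟨y, (hmemS y).2 ⟨Ne.symm hK, hyb⟩, rfl⟩))
      · by_cases hbe : b ∈ e
        · obtain ⟨y, rfl⟩ := hbe
          refine .inr (.inr (.inr ⟨y, (hmemS y).2 ⟨?_, Ne.symm hK⟩, rfl⟩))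
          rintro rfl
          exact hae (Sym2.mem_mk_right _ _)
        · refine .inr (.inl (Finset.mem_filter.2 ⟨Finset.mem_univ _, ?_, hae, hbe, heU⟩))
          exact SimpleGraph.not_isDiag_of_mem_edgeSet _ hK
  have hmod : (L.card + 2 * S.card + 1) % 3 = 0 := by
    have h₁ : {e | e ∈ {s(a, b)} + cone a b S L}.ncard = L.card + 2 * S.card + 1 := by
      rw [← card_singleton_add_cone (a := a) (b := b),
        ← Multiset.toFinset_card_of_nodup hnodup, ← Set.ncard_coe_finset]
      congr 1
      ext e
      simp
    have h₂ : (completeGraph α).edgeSet.ncard = (Fintype.card α).choose 2 := by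
      rw [← card_edgeFinset_top_eq_card_choose_two, ← Set.ncard_coe_finset, coe_edgeFinset]
    have h₃ := Set.ncard_sdiff_add_ncard_of_subset hUE
    rw [← hset, h₁, h₂] at h₃
    omega
  obtain ⟨B₂, hB₂, hB₂U⟩ :=
    (hG.pathDecomposable hab hmod (by omega)).exists_isPartialDesign hnodup
  rw [hset] at hB₂U
  refine ⟨B ∪ B₂, Set.subset_union_left, ⟨?_, ?_⟩, ?_⟩
  · rintro H (hH | hH)
    exacts [hB.1 H hH, hB₂.1 H hH]
  · refine Set.pairwiseDisjoint_union.2 ⟨hB.2, hB₂.2, fun H hH K hK _ => ?_⟩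
    refine Set.disjoint_of_subset (Set.subset_biUnion_of_mem hH)
      ((Set.subset_biUnion_of_mem hK).trans hB₂U.subset) Set.disjoint_sdiff_right
  · rw [Set.biUnion_union, hB₂U]
    exact Set.union_sdiff_cancel hUE

theorem three_dvd_choose_two {n : ℕ} (hmod : n ≡ 0 [MOD 3] ∨ n ≡ 1 [MOD 3]) :
    3 ∣ n.choose 2 := by
  have h : 2 * n.choose 2 = n * (n - 1) := by
    rw [Nat.choose_two_right, Nat.two_mul_div_two_of_even (Nat.even_mul_pred_self n)]
  refine (show Nat.Coprime 3 2 by norm_num).dvd_of_dvd_mul_left (h ▸ ?_)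
  rcases hmod with h0 | h1
  · exact Dvd.dvd.mul_right ((Nat.modEq_zero_iff_dvd).1 h0) _
  · refine Dvd.dvd.mul_left ?_ _
    unfold Nat.ModEq at h1
    omega

end

end PathDesign

theorem theorem3p1 {V W : Type*} [Fintype V] [Fintype W] (v n : ℕ)
    (hv : Fintype.card V = v) (hn : Fintype.card W = n)
    (B : Set (SimpleGraph.completeGraph V).Subgraph)
    (hB : PathDesign.IsPartialDesign (SimpleGraph.completeGraph V) (SimpleGraph.pathGraph 4) B)
    (hvn : v + 2 ≤ n) (hmod : n ≡ 0 [MOD 3] ∨ n ≡ 1 [MOD 3]) (hn3 : n ≠ 3) :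
    ∃ B' : Set (SimpleGraph.completeGraph W).Subgraph,
      PathDesign.IsDesign (SimpleGraph.completeGraph W) (SimpleGraph.pathGraph 4) B' ∧
        PathDesign.EmbedsInto B B' := by
  classical
  subst hv hn
  obtain ⟨f⟩ := Function.Embedding.nonempty_of_card_le
    (show Fintype.card V ≤ Fintype.card W by omega)
  have hcard : 1 < (Finset.univ \ Finset.univ.map f).card := by
    have := Finset.card_sdiff_add_card_eq_card (Finset.subset_univ (Finset.univ.map f))
    rw [Finset.card_map, Finset.card_univ, Finset.card_univ] at this
    omega
  obtain ⟨a, ha, b, hb, hab⟩ := Finset.one_lt_card.1 hcard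
  have hrange : ∀ c ∈ Finset.univ \ Finset.univ.map f, ∀ x, f x ≠ c := by simp
  let φ : SimpleGraph.Copy (SimpleGraph.completeGraph V) (SimpleGraph.completeGraph W) :=
    (SimpleGraph.Embedding.completeGraph f).toCopy
  have hverts : ∀ c ∈ Finset.univ \ Finset.univ.map f,
      ∀ H ∈ (fun H => H.map φ.toHom) '' B, c ∉ H.verts := by
    rintro c hc _ ⟨H, -, rfl⟩ ⟨x, -, hx⟩
    exact hrange c hc x hx
  obtain ⟨B', hBB', hB'⟩ := (hB.map φ).exists_isDesign hab (hverts a ha) (hverts b hb)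
    (PathDesign.three_dvd_choose_two hmod) hn3
  exact ⟨B', hB', φ, fun H hH => hBB' ⟨H, hH, rfl⟩⟩
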